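/- Consider diagrams of oriented tangles in an oriented disk $C\subset\mathbb R^2$, with the ends of all strands on $\partial C$. An oriented Reidemeister move $\Omega$ replaces, inside a disk $C$ (its changing disk), one of the two diagrams of a pair $(R,R')$ with the same ends by the other; a move is not distinguished from its inverse. There are sixteen moves. Type one: creation of a loop on a strand. The sign of the new crossing and the change of the winding number are $(+,-1)$ for $\Omega1a$, $(+,+1)$ for $\Omega1b$, $(-,-1)$ for $\Omega1c$ and $(-,+1)$ for $\Omega1d$ (a counterclockwise loop changes the winding number by $+1$). Type two: creation of a bigon between two strands, one of which passes over the other at both new crossings. In $\Omega2a$ and $\Omega2b$ the two strands have the same direction, and the signs of the crossings met along each of them are $+,-$ for $\Omega2a$ and $-,+$ for $\Omega2b$. In $\Omega2c$ and $\Omega2d$ the two strands have opposite directions, and the signs met along the upper strand are $-,+$ for $\Omega2c$ and $+,-$ for $\Omega2d$. Type three: a top, a middle and a bottom strand cross pairwise, and one of them is pushed across the crossing of the other two. There are eight such moves, one for each choice of the signs of the three crossings; $\Omega3b$ is the one with three positive crossings. A set $S$ of oriented Reidemeister moves is called generating if, for each of the sixteen moves $\Omega$, one can pass from $R$ to $R'$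 by a finite sequence of isotopies and of moves from $S$ (and their inverses), all inside the changing disk of $\Omega$. **Theorem.** Let $S$ be a set of at most five oriented Reidemeister moves which contains exactly one move of type three, namely $\Omega3b$. Then $S$ is generating if and only if $S$ contains $\Omega2c$ and $\Omega2d$ and contains at least one of the pairs $(\Omega1a,\Omega1b)$, $(\Omega1a,\Omega1c)$, $(\Omega1b,\Omega1d)$, $(\Omega1c,\Omega1d)$. -/

import Mathlib

/-!
Oriented tangle diagrams in a disk, up to isotopy fixing the boundary of the disk, and the oriented
Reidemeister moves on them.

A diagram all of whose components are arcs with their ends on the boundary circle forms, together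
with that circle, a connected plane graph.  Hence its isotopy class is determined by, and may be
replaced by, the combinatorial plane graph: the crossings met along each strand (with over/under
information and the crossing sign), the cyclic order of the ends on the boundary circle, and the
condition that the resulting cell structure has the Euler characteristic of the sphere.
The moves never create or destroy closed components, so only diagrams without closed components
occur inside the changing disk of a Reidemeister move.
-/

namespace Reidemeister

/-- One passage of a strand through a crossing: the name of the crossing, whether the strand is
the upper one there, and whether the sign (local writhe) of the crossing is `+1`. -/
structure Passage where
  crossing : ℕ
  upper : Bool
  positive : Bool
deriving DecidableEq

namespace Passage

/-- The passage of the other strand through the same crossing. -/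
def partner (p : Passage) : Passage := ⟨p.crossing, !p.upper, p.positive⟩

/-- Renaming of crossings. -/
def relabel (σ : Equiv.Perm ℕ) (p : Passage) : Passage := ⟨σ p.crossing, p.upper, p.positive⟩

end Passage

/-- The ends of `m` oriented strands: `terminal = false` is the initial point of the strand,
`terminal = true` is its terminal point. -/
structure Endpoint (m : ℕ) where
  strand : Fin m
  terminal : Bool
deriving DecidableEq

/-- The list of the `2 m` ends of `m` strands in the counterclockwise order in which they lie on the
boundary circle of the disk, starting anywhere. -/
structure Boundary (m : ℕ) where
  order : List (Endpoint m)
  nodup : order.Nodup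
  complete : ∀ (i : Fin m) (t : Bool), ⟨i, t⟩ ∈ order

/-- The end that follows `e` counterclockwise on the boundary circle. -/
def Boundary.next {m : ℕ} (b : Boundary m) (e : Endpoint m) : Endpoint m := b.order.formPerm e

/-- The sequence of passages met along each of `m` strands, following its orientation. -/
abbrev Code (m : ℕ) : Type := Fin m → List Passage

namespace Code

variable {m : ℕ}

/-- All passages of all strands. -/
def passages (D : Code m) : List Passage := (List.ofFn D).flatten

/-- Every crossing that occurs is passed exactly twice, once over and once under, and both passages
record the same sign. -/
def Valid (D : Code m) : Prop :=
  (D.passages.map fun p => (p.crossing, p.upper)).Nodup ∧ ∀ p ∈ D.passages, p.partner ∈ D.passages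

/-- The number of crossings. -/
def crossings (D : Code m) : ℕ := (D.passages.filter fun p => p.upper).length

/-- The strand that contains the passage `p`, and the position (counted from `0`) of `p` on it. -/
def locate (D : Code m) (p : Passage) : Option (Fin m × ℕ) :=
  (List.finRange m).findSome? fun i => ((D i).findIdx? fun q => decide (q = p)).map fun j => (i, j)

end Code

/-- An arc of a diagram with a direction of travel. The crossings cut the strand `i` with `l`
passages into the arcs `0, …, l`; the arc `j` leads from passage `j - 1` (or the initial point, if
`j = 0`) to passage `j` (or the terminal point, if `j = l`). `forward` tells whether one travels
along the orientation of the strand. -/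
structure Dart (m : ℕ) where
  strand : Fin m
  arc : ℕ
  forward : Bool
deriving DecidableEq

namespace Code

variable {m : ℕ}

/-- All darts of a diagram. -/
def darts (D : Code m) : Finset (Dart m) :=
  Finset.univ.biUnion fun i => (Finset.range ((D i).length + 1)).biUnion fun j =>
    {⟨i, j, true⟩, ⟨i, j, false⟩}

/-- What one meets at the head of a dart: a passage of its strand, or an end of the strand. -/
def head (D : Code m) (d : Dart m) : Passage ⊕ Endpoint m :=
  if d.forward then
    match (D d.strand)[d.arc]? with
    | some p => Sum.inl p
    | none => Sum.inr ⟨d.strand, true⟩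
  else
    match d.arc with
    | 0 => Sum.inr ⟨d.strand, false⟩
    | j + 1 =>
      match (D d.strand)[j]? with
      | some p => Sum.inl p
      | none => Sum.inr ⟨d.strand, true⟩

/-- The dart that enters the disk at the end `e`. -/
def entering (D : Code m) (e : Endpoint m) : Dart m :=
  if e.terminal then ⟨e.strand, (D e.strand).length, false⟩ else ⟨e.strand, 0, true⟩

/-- The next dart along the boundary of the face to the left of `d`.
At a crossing one turns left into the other strand. With the lower strand crossing the upper strand
from right to left at a positive crossing and from left to right at a negative one, that turn keeps
the direction of travel (with or against the orientation) if one arrives on the upper strand of a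
positive or on the lower strand of a negative crossing, and reverses it otherwise.
At the boundary circle one turns left too, and follows the circle counterclockwise up to
the next end. -/
def faceNext (b : Boundary m) (D : Code m) (d : Dart m) : Dart m :=
  match D.head d with
  | Sum.inr e => D.entering (b.next e)
  | Sum.inl p =>
    match D.locate p.partner with
    | none => d
    | some (i, j) => if d.forward == (p.upper == p.positive) then ⟨i, j + 1, true⟩ else ⟨i, j, false⟩

/-- The set of darts that have the same face on their left as `d`. -/
def face (b : Boundary m) (D : Code m) (d : Dart m) : Finset (Dart m) :=
  (Finset.range D.darts.card).image fun n => (D.faceNext b)^[n] d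

/-- The faces into which the diagram cuts the disk, each given by the darts that have it on their
left. -/
def faces (b : Boundary m) (D : Code m) : Finset (Finset (Dart m)) := D.darts.image (D.face b)

/-- The diagram can be drawn in the disk: shrinking the boundary circle to one vertex gives a
connected cell decomposition with `crossings + 1` vertices, `2 * crossings + m` edges and the faces
above; it is one of the sphere iff `V - E + F = 2`. -/
def Planar (b : Boundary m) (D : Code m) : Prop :=
  ((D.crossings : ℤ) + 1) - (2 * D.crossings + m) + (D.faces b).card = 2

instance (D : Code m) : Decidable D.Valid := by unfold Valid; infer_instance

instance (b : Boundary m) (D : Code m) : Decidable (D.Planar b) := by unfold Planar; infer_instance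

end Code

/-- A diagram, in the disk with the marked points `b` on its boundary, of a tangle of `m` oriented
strands (without closed components). -/
structure Tangle {m : ℕ} (b : Boundary m) where
  code : Code m
  valid : code.Valid
  planar : code.Planar b

/-- Two tangle diagrams are isotopic relative to the boundary of the disk: their codes agree up to
the names of the crossings. -/
def Isotopic {m : ℕ} {b : Boundary m} (D D' : Tangle b) : Prop :=
  ∃ σ : Equiv.Perm ℕ, ∀ i, D'.code i = (D.code i).map (Passage.relabel σ)

/-- The part of a diagram outside a smaller disk, the changing disk, which is met by `k` pieces of
the strands: the symbol `Sum.inr h` stands for the `h`-th piece. -/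
abbrev Outside (m k : ℕ) : Type := Fin m → List (Passage ⊕ Fin k)

/-- The strands of the diagram that coincides with `K` outside the changing disk, and
with `R` inside. -/
def Outside.fill {m k : ℕ} (K : Outside m k) (R : Code k) : Code m := fun i =>
  (K i).flatMap fun x => match x with
    | Sum.inl p => [p]
    | Sum.inr h => R h

/-- `D` and `D'` coincide outside a changing disk and look as `R` and `R'` inside it; each strand of
`R` occurs exactly once.
This is used for moves, where at least one side, say `R`, is connected and has all its arcs between
crossings on the boundary of one inner face (a monogon, bigon or triangle). As faces are traced
locally, that face is also a face of `D`, and the pieces of `D` that spell `R` have, together with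
it, a disk as their neighbourhood; that disk is the changing disk. -/
def Replace {m k : ℕ} {b : Boundary m} (R R' : Code k) (D D' : Tangle b) : Prop :=
  ∃ K : Outside m k, (∀ h : Fin k, ∑ i, (K i).count (Sum.inr h) = 1) ∧
    D.code = K.fill R ∧ D'.code = K.fill R'

/-- The sixteen oriented Reidemeister moves (a move is not distinguished from its inverse).
Type one: the sign of the crossing and the change of the winding number under
creation of the loop are `(+, -)` for `Ω1a`, `(+, +)` for `Ω1b`, `(-, -)` for `Ω1c` and
`(-, +)` for `Ω1d`.
Type two: `Ω2a`, `Ω2b` have two strands with the same direction, and the signs met along each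
strand are `+, -` for `Ω2a` and `-, +` for `Ω2b`; `Ω2c`, `Ω2d` have two strands with opposite
directions, and the signs met along the upper strand are `-, +` for `Ω2c` and `+, -` for `Ω2d`.
Type three: the signs of the crossings of the top strand with the middle one, of the top strand
with the bottom one and of the middle strand with the bottom one (`true` for `+`) may be
arbitrary, and determine the move. -/
inductive Move where
  | Ω1a | Ω1b | Ω1c | Ω1d
  | Ω2a | Ω2b | Ω2c | Ω2d
  | Ω3 (tm tb mb : Bool)
deriving DecidableEq

namespace Move

/-- The type-three move with three positive crossings. -/
abbrev Ω3b : Move := Ω3 true true true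

/-- The number of strands of the move. -/
@[reducible] def strands : Move → ℕ
  | Ω1a | Ω1b | Ω1c | Ω1d => 1
  | Ω2a | Ω2b | Ω2c | Ω2d => 2
  | Ω3 _ _ _ => 3

/-- Passage over the crossing `c` of sign `s`. -/
def o (c : ℕ) (s : Bool) : Passage := ⟨c, true, s⟩

/-- Passage under the crossing `c` of sign `s`. -/
def u (c : ℕ) (s : Bool) : Passage := ⟨c, false, s⟩

/-- The left side of the move. For type two, strand `0` is the upper one. For type three, strand `0`
is the top one, strand `1` the middle one and strand `2` the bottom one, and they are straight
lines with a common point, except that the bottom line has been pushed off that point to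
its right; crossing `0` is that of top and middle, `1` of top and bottom, `2` of
middle and bottom. -/
def left : (Ω : Move) → Code Ω.strands
  | Ω1a | Ω1b | Ω1c | Ω1d => ![[]]
  | Ω2a | Ω2b | Ω2c | Ω2d => ![[], []]
  | Ω3 tm tb mb =>
    ![if tb then [o 0 tm, o 1 tb] else [o 1 tb, o 0 tm],
      if mb then [u 0 tm, o 2 mb] else [o 2 mb, u 0 tm],
      if tm == (tb == mb) then [u 1 tb, u 2 mb] else [u 2 mb, u 1 tb]]

/-- The right side of the move. For type three, the bottom line has been pushed to its left. -/
def right : (Ω : Move) → Code Ω.strands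
  | Ω1a => ![[o 0 true, u 0 true]]
  | Ω1b => ![[u 0 true, o 0 true]]
  | Ω1c => ![[u 0 false, o 0 false]]
  | Ω1d => ![[o 0 false, u 0 false]]
  | Ω2a => ![[o 0 true, o 1 false], [u 0 true, u 1 false]]
  | Ω2b => ![[o 0 false, o 1 true], [u 0 false, u 1 true]]
  | Ω2c => ![[o 0 false, o 1 true], [u 1 true, u 0 false]]
  | Ω2d => ![[o 0 true, o 1 false], [u 1 false, u 0 true]]
  | Ω3 tm tb mb =>
    ![if tb then [o 1 tb, o 0 tm] else [o 0 tm, o 1 tb],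
      if mb then [o 2 mb, u 0 tm] else [u 0 tm, o 2 mb],
      if tm == (tb == mb) then [u 2 mb, u 1 tb] else [u 1 tb, u 2 mb]]

/-- The ends of the strands of the move, counterclockwise. For type three the list starts with the
terminal point of the top strand; to the left of the top strand lies the terminal point of the
middle strand if `tm` and its initial point otherwise, and likewise for the bottom strand. -/
def ends : (Ω : Move) → List (Endpoint Ω.strands)
  | Ω1a | Ω1b | Ω1c | Ω1d => [⟨(0 : Fin 1), false⟩, ⟨(0 : Fin 1), true⟩]
  | Ω2a => [⟨(0 : Fin 2), false⟩, ⟨(1 : Fin 2), false⟩, ⟨(1 : Fin 2), true⟩, ⟨(0 : Fin 2), true⟩]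
  | Ω2b => [⟨(1 : Fin 2), false⟩, ⟨(0 : Fin 2), false⟩, ⟨(0 : Fin 2), true⟩, ⟨(1 : Fin 2), true⟩]
  | Ω2c => [⟨(0 : Fin 2), false⟩, ⟨(1 : Fin 2), true⟩, ⟨(1 : Fin 2), false⟩, ⟨(0 : Fin 2), true⟩]
  | Ω2d => [⟨(1 : Fin 2), true⟩, ⟨(0 : Fin 2), false⟩, ⟨(0 : Fin 2), true⟩, ⟨(1 : Fin 2), false⟩]
  | Ω3 tm tb mb =>
    if tm == (tb == mb) then
      [⟨(0 : Fin 3), true⟩, ⟨(1 : Fin 3), tm⟩, ⟨(2 : Fin 3), tb⟩,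
        ⟨(0 : Fin 3), false⟩, ⟨(1 : Fin 3), !tm⟩, ⟨(2 : Fin 3), !tb⟩]
    else
      [⟨(0 : Fin 3), true⟩, ⟨(2 : Fin 3), tb⟩, ⟨(1 : Fin 3), tm⟩,
        ⟨(0 : Fin 3), false⟩, ⟨(2 : Fin 3), !tb⟩, ⟨(1 : Fin 3), !tm⟩]

/-- The boundary of the standard disk in which the move is drawn. -/
def boundary (Ω : Move) : Boundary Ω.strands where
  order := Ω.ends
  nodup := by rcases Ω with _ | _ | _ | _ | _ | _ | _ | _ | ⟨_ | _, _ | _, _ | _⟩ <;> decide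
  complete := by rcases Ω with _ | _ | _ | _ | _ | _ | _ | _ | ⟨_ | _, _ | _, _ | _⟩ <;> decide

/-- The left side of the move, as a diagram in the standard disk. -/
def before (Ω : Move) : Tangle Ω.boundary where
  code := Ω.left
  valid := by rcases Ω with _ | _ | _ | _ | _ | _ | _ | _ | ⟨_ | _, _ | _, _ | _⟩ <;> decide
  planar := by rcases Ω with _ | _ | _ | _ | _ | _ | _ | _ | ⟨_ | _, _ | _, _ | _⟩ <;> decide +kernel

/-- The right side of the move, as a diagram in the standard disk. -/
def after (Ω : Move) : Tangle Ω.boundary where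
  code := Ω.right
  valid := by rcases Ω with _ | _ | _ | _ | _ | _ | _ | _ | ⟨_ | _, _ | _, _ | _⟩ <;> decide
  planar := by rcases Ω with _ | _ | _ | _ | _ | _ | _ | _ | ⟨_ | _, _ | _, _ | _⟩ <;> decide +kernel

end Move

/-- One step of a sequence inside a disk: an isotopy, or one of the moves of `S` (from its
left side to its right side). -/
inductive Step (S : Finset Move) {m : ℕ} {b : Boundary m} (D D' : Tangle b) : Prop
  | isotopy (h : Isotopic D D')
  | move (Ω : Move) (hΩ : Ω ∈ S) (h : Replace Ω.left Ω.right D D')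

/-- `D'` can be obtained from `D` by a finite sequence of isotopies, moves of `S` and their
inverses, all inside the disk. -/
def Obtainable (S : Finset Move) {m : ℕ} {b : Boundary m} (D D' : Tangle b) : Prop :=
  Relation.EqvGen (Step S) D D'

/-- `S` is a generating set: every oriented Reidemeister move can be obtained by a finite sequence
of isotopies and moves of `S` inside its changing disk. -/
def Generates (S : Finset Move) : Prop := ∀ Ω : Move, Obtainable S Ω.before Ω.after

end Reidemeister

/-!
Necessity. Two kinds of invariants of the codes, which do not need planarity, exclude the other
sets.

On a single strand, add up the signs of the crossings that are first passed over. Only `Ω1a` and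
`Ω1d` change this number, and the same sum for the crossings first passed under is changed only by
`Ω1b` and `Ω1c`. So `S` needs a move of each of these two pairs (`Generates.type_one`), and this is
the condition on the moves of type one in the theorem.

For the moves of type two, states are transported along the strands, and one asks which states at
the ends a diagram admits. This is a local condition, so it suffices to compare the two sides of
each move (`Obtainable.admits_iff`). Smoothing all crossings according to the orientation connects
the ends in a way that only `Ω2c` and `Ω2d` change among the moves considered (`smoothing_local`).
Other states count, with signs, the passages on a given level of the crossings of one strand over
another. Such a counter stops at `0`: one step up followed by one step down is the identity, but
one step down followed by one step up is not. So the order of the two signs in a bigon becomes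
visible. The four choices of the level and of the sign that counts
upwards each give an invariant of `Ω3b`, of all moves of type one and of two of the moves of type
two (`counting_local`). As `S` has at most five elements, at most two of them are of type two, and
the pair of `Ω2c` and `Ω2d` is the only one that meets all five conditions (`Generates.type_two`).

Sufficiency. Explicit sequences of moves are given in `route`. `Ω2c` and `Ω2d` exchange `Ω1a` with
`Ω1d` and `Ω1b` with `Ω1c`; these moves together with `Ω3b` yield `Ω2a` and `Ω2b`; and conjugating
`Ω3b` with moves of type two yields the other moves of type three. A route for a derived move is
drawn inside the changing disk wherever that move occurs (`expandRoute`), and it is verified by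
computation that every step of the resulting sequence is a move of `S` and that every intermediate
diagram can be drawn in the disk. For the latter, the faces are listed by tracing their boundaries,
which is shown to give their number in `Code.card_faces`.
-/

namespace Reidemeister

/-! ### Filling a changing disk -/

section Fill

variable {m k : ℕ}

/-- The derived test for equality in a sum, by which symbols of `Outside` are counted in `Replace`,
is a lawful one. -/
instance Sum.lawfulBEq {α β : Type*} [BEq α] [BEq β] [LawfulBEq α] [LawfulBEq β] :
    LawfulBEq (α ⊕ β) where
  eq_of_beq {x y} h := by
    cases x <;> cases y <;> first
      | exact congrArg _ (eq_of_beq h)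
      | exact absurd h Bool.false_ne_true
  rfl {x} := by
    rcases x with a | a
    · exact beq_self_eq_true a
    · exact beq_self_eq_true a

/-- Each piece of strand inside the changing disk occurs exactly once. -/
def Outside.Linear (K : Outside m k) : Prop := ∀ h : Fin k, ∑ i, (K i).count (Sum.inr h) = 1

/-- No crossing outside the changing disk has the name of a crossing of `R`. -/
def Outside.Apart (K : Outside m k) (R : Code k) : Prop :=
  ∀ i p, Sum.inl p ∈ K i → ∀ h, ∀ q ∈ R h, p.crossing ≠ q.crossing

/-- What a symbol of `Outside` stands for when the changing disk is filled with `R`. -/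
def piece (R : Code k) : Passage ⊕ Fin k → List Passage
  | Sum.inl p => [p]
  | Sum.inr h => R h

theorem Outside.fill_eq (K : Outside m k) (R : Code k) (i : Fin m) :
    K.fill R i = (K i).flatMap (piece R) := by
  unfold Outside.fill
  congr 1

theorem Outside.Linear.exists_mem {K : Outside m k} (hK : K.Linear) (h : Fin k) :
    ∃ i, Sum.inr h ∈ K i := by
  by_contra hne
  push Not at hne
  have h1 := hK h
  rw [Finset.sum_eq_zero fun i _ => List.count_eq_zero_of_not_mem (hne i)] at h1
  exact zero_ne_one h1

theorem Outside.Linear.count_le {K : Outside m k} (hK : K.Linear) (h : Fin k) (i : Fin m) :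
    (K i).count (Sum.inr h) ≤ 1 :=
  (hK h) ▸ Finset.single_le_sum (f := fun i => (K i).count (Sum.inr h))
    (fun _ _ => Nat.zero_le _) (Finset.mem_univ i)

theorem Outside.Linear.unique {K : Outside m k} (hK : K.Linear) {h : Fin k} {i j : Fin m}
    (hi : Sum.inr h ∈ K i) (hj : Sum.inr h ∈ K j) : i = j := by
  by_contra hij
  have h1 := hK h
  have h2 := Finset.sum_le_sum_of_subset (f := fun i => (K i).count (Sum.inr h))
    (Finset.subset_univ {i, j})
  rw [Finset.sum_pair hij, h1] at h2
  have h3 := List.count_pos_iff.2 hi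
  have h4 := List.count_pos_iff.2 hj
  omega

theorem Code.mem_passages {D : Code m} {p : Passage} : p ∈ D.passages ↔ ∃ i, p ∈ D i := by
  simp [Code.passages, List.mem_flatten]

/-- In a valid diagram the crossings inside the changing disk do not occur outside it. -/
theorem Outside.apart_of_valid {K : Outside m k} (hK : K.Linear) {R : Code k} (hR : R.Valid)
    (hD : (K.fill R).Valid) : K.Apart R := by
  intro i p hp h q hq hpq
  obtain ⟨q', hq', hk⟩ : ∃ q', (∃ h, q' ∈ R h) ∧
      (fun p : Passage => (p.crossing, p.upper)) q' = (p.crossing, p.upper) := by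
    by_cases hu : q.upper = p.upper
    · exact ⟨q, ⟨h, hq⟩, by simp [hpq, hu]⟩
    · refine ⟨q.partner, Code.mem_passages.1 (hR.2 q (Code.mem_passages.2 ⟨h, hq⟩)), ?_⟩
      simp only [Passage.partner, hpq, Prod.mk.injEq, true_and]
      revert hu
      cases q.upper <;> cases p.upper <;> simp
  obtain ⟨h', hq'⟩ := hq'
  obtain ⟨j, hj⟩ := hK.exists_mem h'
  have hnd := hD.1
  rw [Code.passages, List.map_flatten, List.nodup_flatten] at hnd
  obtain ⟨hnd, hdis⟩ := hnd
  have hpi : p ∈ K.fill R i := by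
    rw [Outside.fill_eq]; exact List.mem_flatMap.2 ⟨_, hp, by simp [piece]⟩
  have hqj : q' ∈ K.fill R j := by
    rw [Outside.fill_eq]; exact List.mem_flatMap.2 ⟨_, hj, hq'⟩
  by_cases hij : i = j
  · subst hij
    have h1 := hnd ((K.fill R i).map fun p => (p.crossing, p.upper)) (by simp)
    rw [Outside.fill_eq, List.map_flatMap, List.nodup_flatMap] at h1
    have : Std.Symm (Function.onFun List.Disjoint
        fun x => (piece R x).map fun p => (p.crossing, p.upper)) := ⟨fun _ _ h => h.symm⟩
    have h2 := h1.2.forall hp hj (by simp)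
    exact h2 (a := (p.crossing, p.upper)) (by simp [piece]) (List.mem_map.2 ⟨q', hq', hk⟩)
  · rw [List.map_ofFn, List.pairwise_ofFn] at hdis
    have key : ∀ {a b : Fin m}, a < b → ∀ {x y : Passage}, x ∈ K.fill R a → y ∈ K.fill R b →
        (x.crossing, x.upper) = (y.crossing, y.upper) → False := by
      intro a b hab x y hx hy hxy
      exact hdis hab (List.mem_map.2 ⟨x, hx, rfl⟩)
        (by rw [hxy]; exact List.mem_map.2 ⟨y, hy, rfl⟩)
    rcases lt_or_gt_of_ne hij with hlt | hlt
    · exact key hlt hpi hqj hk.symm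
    · exact key hlt hqj hpi hk

end Fill

/-! ### Invariants from states propagating along the strands -/

section States

variable {X W : Type*} {m k : ℕ}

/-- Following the passages of `L`, a state `x` can become the state `y`. Here `T` gives the
admissible changes of state at a passage, which depend on its level, its sign and on the datum `w`
shared by the two passages of a crossing. -/
def Flow (T : Bool → Bool → W → X → X → Prop) (w : ℕ → W) : X → List Passage → X → Prop
  | x, [], y => x = y
  | x, p :: L, y => ∃ z, T p.upper p.positive (w p.crossing) x z ∧ Flow T w z L y

/-- The crossings of `D` can be given data such that on each strand `i` the state `(s i).1` at the
initial point becomes the state `(s i).2` at the terminal point. -/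
def Admits (T : Bool → Bool → W → X → X → Prop) (s : Fin m → X × X) (D : Code m) : Prop :=
  ∃ w, ∀ i, Flow T w (s i).1 (D i) (s i).2

/-- `Flow` for a strand outside the changing disk, which acts on its piece `h` inside the disk by
changing the state `(a h).1` into `(a h).2`. -/
def OuterFlow (T : Bool → Bool → W → X → X → Prop) (w : ℕ → W) (a : Fin k → X × X) :
    X → List (Passage ⊕ Fin k) → X → Prop
  | x, [], y => x = y
  | x, Sum.inl p :: L, y =>
      ∃ z, T p.upper p.positive (w p.crossing) x z ∧ OuterFlow T w a z L y
  | x, Sum.inr h :: L, y => x = (a h).1 ∧ OuterFlow T w a (a h).2 L y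

variable {T : Bool → Bool → W → X → X → Prop}

theorem Flow.append {w : ℕ → W} {L L' : List Passage} {x y : X} :
    Flow T w x (L ++ L') y ↔ ∃ z, Flow T w x L z ∧ Flow T w z L' y := by
  induction L generalizing x with
  | nil => simp [Flow]
  | cons p L ih =>
    simp only [List.cons_append, Flow, ih]
    constructor
    · rintro ⟨z, hz, z', h1, h2⟩; exact ⟨z', ⟨z, hz, h1⟩, h2⟩
    · rintro ⟨z', ⟨z, hz, h1⟩, h2⟩; exact ⟨z, hz, z', h1, h2⟩

theorem Flow.congr {w w' : ℕ → W} {L : List Passage} (h : ∀ p ∈ L, w p.crossing = w' p.crossing)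
    {x y : X} : Flow T w x L y ↔ Flow T w' x L y := by
  induction L generalizing x with
  | nil => rfl
  | cons p L ih =>
    simp only [Flow]
    rw [h p (by simp)]
    exact exists_congr fun z => and_congr_right fun _ => ih fun p hp => h p (by simp [hp])

theorem Flow.map_relabel {w : ℕ → W} {σ : Equiv.Perm ℕ} {L : List Passage} {x y : X} :
    Flow T w x (L.map (Passage.relabel σ)) y ↔ Flow T (w ∘ σ) x L y := by
  induction L generalizing x with
  | nil => rfl
  | cons p L ih => simp only [List.map_cons, Flow, ih]; rfl

theorem OuterFlow.congr {w w' : ℕ → W} {a a' : Fin k → X × X} {L : List (Passage ⊕ Fin k)}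
    (h : ∀ p, Sum.inl p ∈ L → w p.crossing = w' p.crossing)
    (ha : ∀ h, Sum.inr h ∈ L → a h = a' h) {x y : X} :
    OuterFlow T w a x L y ↔ OuterFlow T w' a' x L y := by
  induction L generalizing x with
  | nil => rfl
  | cons q L ih =>
    have ih' := @ih (fun p hp => h p (by simp [hp])) (fun p hp => ha p (by simp [hp]))
    cases q with
    | inl p =>
      simp only [OuterFlow]
      rw [h p (by simp)]
      exact exists_congr fun z => and_congr_right fun _ => ih'
    | inr j =>
      simp only [OuterFlow]
      rw [ha j (by simp), ih']

theorem OuterFlow.fill {w : ℕ → W} {a : Fin k → X × X} {R : Code k}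
    {L : List (Passage ⊕ Fin k)} {x y : X} (h : OuterFlow T w a x L y)
    (ha : ∀ h, Flow T w (a h).1 (R h) (a h).2) : Flow T w x (L.flatMap (piece R)) y := by
  induction L generalizing x with
  | nil => exact h
  | cons q L ih =>
    cases q with
    | inl p =>
      obtain ⟨z, hz, h⟩ := h
      exact ⟨z, hz, ih h⟩
    | inr j =>
      obtain ⟨rfl, h⟩ := h
      exact Flow.append.2 ⟨_, ha j, ih h⟩

/-- The states found before and after each piece inside the changing disk are what the outside needs
to know about it. -/
theorem Flow.exists_outer {w : ℕ → W} {R : Code k} {L : List (Passage ⊕ Fin k)}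
    (hL : ∀ h, L.count (Sum.inr h) ≤ 1) {x y : X} (h : Flow T w x (L.flatMap (piece R)) y) :
    ∃ a : Fin k → X × X, OuterFlow T w a x L y ∧
      ∀ h, Sum.inr h ∈ L → Flow T w (a h).1 (R h) (a h).2 := by
  induction L generalizing x with
  | nil => exact ⟨fun _ => (x, x), h, by simp⟩
  | cons q L ih =>
    have hL' : ∀ h, L.count (Sum.inr h) ≤ 1 := fun h => (List.count_le_count_cons).trans (hL h)
    cases q with
    | inl p =>
      obtain ⟨z, hz, h⟩ := h
      obtain ⟨a, h1, h2⟩ := ih hL' h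
      exact ⟨a, ⟨z, hz, h1⟩, fun h hh => h2 h (by simpa using hh)⟩
    | inr j =>
      obtain ⟨z, h0, h⟩ := Flow.append.1 h
      obtain ⟨a, h1, h2⟩ := ih hL' h
      have hj : Sum.inr j ∉ L := by
        intro hj
        have := hL j
        rw [List.count_cons_self] at this
        have := List.count_pos_iff.2 hj
        omega
      refine ⟨Function.update a j (x, z), ⟨by simp, ?_⟩, fun h hh => ?_⟩
      · rw [Function.update_self]
        refine (OuterFlow.congr (fun _ _ => rfl) fun h hh => ?_).1 h1
        rw [Function.update_of_ne]
        rintro rfl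
        exact hj hh
      · by_cases hhj : h = j
        · subst hhj
          rw [Function.update_self]
          exact h0
        · rw [Function.update_of_ne hhj]
          exact h2 h (by simpa [hhj] using hh)

/-- A diagram admits given states at the ends iff the parts inside and outside the
changing disk do so with common states where the strands enter and leave that disk. -/
theorem Outside.admits_fill {K : Outside m k} (hK : K.Linear) {R : Code k} (hR : K.Apart R)
    {s : Fin m → X × X} :
    Admits T s (K.fill R) ↔
      ∃ a : Fin k → X × X, (∃ w, ∀ i, OuterFlow T w a (s i).1 (K i) (s i).2) ∧ Admits T a R := by
  constructor
  · rintro ⟨w, hw⟩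
    choose a h1 h2 using fun i => Flow.exists_outer (fun h => hK.count_le h i)
      (by simpa only [Outside.fill_eq] using hw i)
    choose j hj using hK.exists_mem
    refine ⟨fun h => a (j h) h, ⟨w, fun i => ?_⟩, w, fun h => h2 (j h) h (hj h)⟩
    refine (OuterFlow.congr (fun _ _ => rfl) fun h hh => ?_).1 (h1 i)
    rw [hK.unique hh (hj h)]
  · rintro ⟨a, ⟨w, hw⟩, w', hw'⟩
    classical
    -- the data inside and outside can be combined, since no crossing lies on both sides
    refine ⟨fun c => if ∃ h, ∃ q ∈ R h, q.crossing = c then w' c else w c, fun i => ?_⟩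
    rw [Outside.fill_eq]
    refine OuterFlow.fill (a := a) ((OuterFlow.congr (fun p hp => ?_) fun _ _ => rfl).1 (hw i))
      fun h => (Flow.congr fun p hp => ?_).1 (hw' h)
    · rw [if_neg]
      rintro ⟨h, q, hq, hc⟩
      exact hR i p hp h q hq hc.symm
    · rw [if_pos ⟨h, p, hp, rfl⟩]

theorem Replace.apart {b : Boundary m} {Ω : Move} {D D' : Tangle b} {K : Outside m Ω.strands}
    (hK : K.Linear) (hD : D.code = K.fill Ω.left) (hD' : D'.code = K.fill Ω.right) :
    K.Apart Ω.left ∧ K.Apart Ω.right :=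
  ⟨K.apart_of_valid hK Ω.before.valid (hD ▸ D.valid),
    K.apart_of_valid hK Ω.after.valid (hD' ▸ D'.valid)⟩

/-- If both sides of each move of `S` admit the same states, then so do diagrams obtainable
from each other. -/
theorem Obtainable.admits_iff {S : Finset Move}
    (hS : ∀ Ω ∈ S, ∀ a, Admits T a Ω.left ↔ Admits T a Ω.right)
    {b : Boundary m} {D D' : Tangle b} (h : Obtainable S D D') (s : Fin m → X × X) :
    Admits T s D.code ↔ Admits T s D'.code := by
  induction h with
  | rel D D' h =>
    cases h with
    | isotopy h =>
      obtain ⟨σ, hσ⟩ := h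
      constructor
      · rintro ⟨w, hw⟩
        refine ⟨w ∘ σ.symm, fun i => ?_⟩
        rw [hσ, Flow.map_relabel, Function.comp_assoc]
        simpa using hw i
      · rintro ⟨w, hw⟩
        refine ⟨w ∘ σ, fun i => ?_⟩
        have := hw i
        rwa [hσ, Flow.map_relabel] at this
    | move Ω hΩ h =>
      obtain ⟨K, hK, hD, hD'⟩ := h
      obtain ⟨h1, h2⟩ := Replace.apart hK hD hD'
      rw [hD, hD', K.admits_fill hK h1, K.admits_fill hK h2]
      simp only [hS Ω hΩ]
  | refl D => rfl
  | symm D D' _ ih => exact ih.symm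
  | trans D D' D'' _ _ ih ih' => exact ih.trans ih'

end States

/-! ### The writhe of the crossings that are first passed on a given level -/

section FirstWrithe

variable {k : ℕ}

/-- The sum of the signs of those crossings of `L` outside the set `s` which are first passed on the
upper (`t = true`) or lower (`t = false`) level. -/
def firstWrithe (t : Bool) : List Passage → Finset ℕ → ℤ
  | [], _ => 0
  | p :: L, s =>
      (if p.crossing ∉ s ∧ p.upper = t then (if p.positive then 1 else -1) else 0) +
        firstWrithe t L (insert p.crossing s)

variable {t : Bool}

theorem firstWrithe_congr {L : List Passage} {s s' : Finset ℕ}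
    (h : ∀ p ∈ L, p.crossing ∈ s ↔ p.crossing ∈ s') : firstWrithe t L s = firstWrithe t L s' := by
  induction L generalizing s s' with
  | nil => rfl
  | cons p L ih =>
    simp only [firstWrithe]
    rw [ih (s := insert p.crossing s) (s' := insert p.crossing s')]
    · simp only [h p (by simp)]
    · intro q hq
      simp only [Finset.mem_insert, h q (by simp [hq])]

theorem firstWrithe_append {L L' : List Passage} {s : Finset ℕ} :
    firstWrithe t (L ++ L') s =
      firstWrithe t L s + firstWrithe t L' (s ∪ (L.map Passage.crossing).toFinset) := by
  induction L generalizing s with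
  | nil => simp [firstWrithe]
  | cons p L ih =>
    simp only [List.cons_append, firstWrithe, ih, add_assoc, List.map_cons, List.toFinset_cons,
      Finset.insert_union, Finset.union_insert]

theorem firstWrithe_map_relabel {σ : Equiv.Perm ℕ} {L : List Passage} {s : Finset ℕ} :
    firstWrithe t (L.map (Passage.relabel σ)) (s.map σ.toEmbedding) = firstWrithe t L s := by
  induction L generalizing s with
  | nil => rfl
  | cons p L ih =>
    have := @ih (insert p.crossing s)
    rw [Finset.map_insert] at this
    simp only [List.map_cons, firstWrithe, ← this]
    simp only [Passage.relabel, Finset.mem_map_equiv, Equiv.symm_apply_apply]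
    rfl

/-- The crossings inside and outside the changing disk contribute separately; inside, only the order
in which the strand runs through the pieces matters. -/
theorem firstWrithe_fill {R : Code k} {L : List (Passage ⊕ Fin k)}
    (h : ∀ p, Sum.inl p ∈ L → ∀ h, ∀ q ∈ R h, p.crossing ≠ q.crossing) {s : Finset ℕ} :
    firstWrithe t (L.flatMap (piece R)) s =
      firstWrithe t (L.filterMap Sum.getLeft?) s +
        firstWrithe t ((L.filterMap Sum.getRight?).flatMap R) s := by
  induction L generalizing s with
  | nil => simp [firstWrithe]
  | cons x L ih =>
    have ih' := fun s => @ih (fun p hp => h p (by simp [hp])) s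
    cases x with
    | inl p =>
      have h1 : firstWrithe t ((L.filterMap Sum.getRight?).flatMap R) (insert p.crossing s) =
          firstWrithe t ((L.filterMap Sum.getRight?).flatMap R) s := by
        refine firstWrithe_congr fun q hq => ?_
        obtain ⟨j, -, hj⟩ := List.mem_flatMap.1 hq
        simp [(h p (by simp) j q hj).symm]
      simp only [List.flatMap_cons, piece, List.singleton_append, firstWrithe,
        List.filterMap_cons, Sum.getLeft?_inl, Sum.getRight?_inl, ih', h1, add_assoc]
    | inr j =>
      have h1 : firstWrithe t (L.filterMap Sum.getLeft?)
          (s ∪ ((R j).map Passage.crossing).toFinset) =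
          firstWrithe t (L.filterMap Sum.getLeft?) s := by
        refine firstWrithe_congr fun p hp => ?_
        have hp' : Sum.inl p ∈ L := by
          obtain ⟨y, hy, hyp⟩ := List.mem_filterMap.1 hp
          rcases y with y | y
          · simp only [Sum.getLeft?_inl, Option.some.injEq] at hyp
            exact hyp ▸ hy
          · simp at hyp
        simp only [Finset.mem_union, List.mem_toFinset, List.mem_map, or_iff_left_iff_imp]
        rintro ⟨q, hq, hc⟩
        exact absurd hc.symm (h p (by simp [hp']) j q hq)
      simp only [List.flatMap_cons, piece, firstWrithe_append, List.filterMap_cons,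
        Sum.getLeft?_inr, Sum.getRight?_inr, ih', h1]
      ring

/-- On a single strand `firstWrithe` is an invariant of `S`, if both sides of each move of `S`
agree for each order in which the strand may run through the pieces inside the changing disk. -/
theorem Obtainable.firstWrithe_eq {S : Finset Move}
    (hS : ∀ Ω ∈ S, ∀ l ∈ (List.finRange Ω.strands).permutations',
      firstWrithe t (l.flatMap Ω.left) ∅ = firstWrithe t (l.flatMap Ω.right) ∅)
    {b : Boundary 1} {D D' : Tangle b} (h : Obtainable S D D') :
    firstWrithe t (D.code 0) ∅ = firstWrithe t (D'.code 0) ∅ := by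
  induction h with
  | rel D D' h =>
    cases h with
    | isotopy h =>
      obtain ⟨σ, hσ⟩ := h
      rw [hσ, ← firstWrithe_map_relabel (σ := σ) (L := D.code 0), Finset.map_empty]
    | move Ω hΩ h =>
      obtain ⟨K, hK, hD, hD'⟩ := h
      obtain ⟨h1, h2⟩ := Replace.apart hK hD hD'
      rw [hD, hD', K.fill_eq, K.fill_eq, firstWrithe_fill (h1 0), firstWrithe_fill (h2 0),
        hS Ω hΩ]
      rw [List.mem_permutations', List.perm_iff_count]
      intro j
      rw [List.count_eq_one_of_mem (List.nodup_finRange _) (List.mem_finRange j),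
        List.count_filterMap]
      refine Eq.trans ?_ ((Fin.sum_univ_one _).symm.trans (hK j))
      rw [List.count]
      congr 1
      funext x
      rcases x with x | x
      · rfl
      · exact Bool.eq_iff_iff.2 (by simp)
  | refl D => rfl
  | symm D D' _ ih => exact ih.symm
  | trans D D' D'' _ _ ih ih' => exact ih.trans ih'

end FirstWrithe

/-! ### The invariants that exclude sets of moves -/

section Necessity

/-- The states `Bool` are transported along the strands smoothed at their crossings according
to the orientation; the datum of a crossing consists of the states at the beginning of its upper and
lower passage. -/
def Smoothing (upper _positive : Bool) (w : Bool × Bool) (x y : Bool) : Prop :=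
  if upper then x = w.1 ∧ y = w.2 else x = w.2 ∧ y = w.1

/-- The new value of a counter of the passages on level `r` of the crossings where the strand
`false` passes over the strand `true`. It goes up if the sign of the crossing is `e`, and down
otherwise. As it stops at `0`, one up after one down need not restore it. -/
def tick (r e upper positive : Bool) (w : Bool × Bool) (n : ℕ) : ℕ :=
  if upper = r ∧ w = (false, true) then (if positive = e then n + 1 else n - 1) else n

/-- A state is the name of a strand together with a counter; the datum of a crossing is the pair of
its upper and lower strand. -/
def Counting (r e upper positive : Bool) (w : Bool × Bool) (x y : Bool × ℕ) : Prop :=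
  (if upper then w.1 else w.2) = x.1 ∧ y = (x.1, tick r e upper positive w x.2)

/-- The changes of a counter on a given level at crossings of the same sign commute, which makes the
counters invariant under `Ω3b`. -/
theorem tick_comm {r e u u' positive : Bool} {w w' : Bool × Bool} {n : ℕ} :
    tick r e u positive w (tick r e u' positive w' n) =
      tick r e u' positive w' (tick r e u positive w n) := by
  unfold tick
  grind

/-- A step up is undone by the step down that follows it. -/
theorem tick_cancel {r e upper positive : Bool} {w : Bool × Bool} {n : ℕ}
    (h : upper = r → positive = e) :
    tick r e upper (!positive) w (tick r e upper positive w n) = n := by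
  unfold tick
  by_cases hw : upper = r ∧ w = (false, true)
  · cases h hw.1
    simp [hw]
  · simp [hw]

variable {X W : Type*} {T : Bool → Bool → W → X → X → Prop}

theorem admits_one {L : List Passage} {a : Fin 1 → X × X} :
    Admits T a ![L] ↔ ∃ w, Flow T w (a 0).1 L (a 0).2 := by
  simp [Admits]

theorem admits_two {L L' : List Passage} {a : Fin 2 → X × X} :
    Admits T a ![L, L'] ↔ ∃ w, Flow T w (a 0).1 L (a 0).2 ∧ Flow T w (a 1).1 L' (a 1).2 := by
  simp [Admits]

theorem admits_three {L L' L'' : List Passage} {a : Fin 3 → X × X} :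
    Admits T a ![L, L', L''] ↔ ∃ w, Flow T w (a 0).1 L (a 0).2 ∧ Flow T w (a 1).1 L' (a 1).2 ∧
      Flow T w (a 2).1 L'' (a 2).2 := by
  simp [Admits, Fin.forall_fin_succ]

/-- In a bigon of strands with the same direction the smoothed strands run in parallel again, and a
loop that is smoothed splits off a circle. Both sides of `Ω3b` exchange the ends of the top and the
bottom strand. Only in `Ω2c` and `Ω2d` are the strands reconnected. -/
theorem smoothing_local {Ω : Move} (hc : Ω ≠ .Ω2c) (hd : Ω ≠ .Ω2d)
    (h3 : ∀ tm tb mb, Ω = .Ω3 tm tb mb → Ω = .Ω3b) (a : Fin Ω.strands → Bool × Bool) :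
    Admits Smoothing a Ω.left ↔ Admits Smoothing a Ω.right := by
  rcases Ω with _ | _ | _ | _ | _ | _ | _ | _ | ⟨tm, tb, mb⟩
  case Ω2c => exact absurd rfl hc
  case Ω2d => exact absurd rfl hd
  case Ω3 =>
    obtain ⟨rfl, rfl, rfl⟩ := (Move.Ω3.injEq ..).mp (h3 _ _ _ rfl)
    refine admits_three.trans (Iff.trans ?_ admits_three.symm)
    simp only [beq_self_eq_true, if_true, Flow, Smoothing, Move.o, Move.u]
    -- the new data are the states of the two strands before each crossing of the other side
    constructor
    · rintro ⟨w, h⟩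
      exact ⟨fun c => if c = 1 then ((a 0).1, (a 1).1) else ((a 1).1, (a 2).1), by grind⟩
    · rintro ⟨w, h⟩
      exact ⟨fun c => if c = 1 then ((a 1).1, (a 2).1) else ((a 0).1, (a 1).1), by grind⟩
  all_goals
    first
      | refine admits_one.trans (Iff.trans ?_ admits_one.symm)
      | refine admits_two.trans (Iff.trans ?_ admits_two.symm)
    simp only [Flow, Smoothing, Move.o, Move.u]
    constructor
    · rintro ⟨-, h⟩
      first
      | exact ⟨fun c => ((a 0).1, (a 0).1), by grind⟩
      | exact ⟨fun c => if c = 0 then ((a 0).1, (a 1).1) else ((a 1).1, (a 0).1), by grind⟩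
    · rintro ⟨w, h⟩
      exact ⟨w, by grind⟩

/-- The conditions say that a strand which passes the two crossings of a bigon on level `r` meets
the sign `e` first, so that its counter goes up and then down. -/
theorem counting_local {r e : Bool} {Ω : Move} (ha : Ω = .Ω2a → e = true)
    (hb : Ω = .Ω2b → e = false) (hc : Ω = .Ω2c → e = !r) (hd : Ω = .Ω2d → e = r)
    (h3 : ∀ tm tb mb, Ω = .Ω3 tm tb mb → Ω = .Ω3b) (a : Fin Ω.strands → (Bool × ℕ) × (Bool × ℕ)) :
    Admits (Counting r e) a Ω.left ↔ Admits (Counting r e) a Ω.right := by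
  rcases Ω with _ | _ | _ | _ | _ | _ | _ | _ | ⟨tm, tb, mb⟩
  case Ω3 =>
    obtain ⟨rfl, rfl, rfl⟩ := (Move.Ω3.injEq ..).mp (h3 _ _ _ rfl)
    refine admits_three.trans (Iff.trans (exists_congr fun w => ?_) admits_three.symm)
    simp only [beq_self_eq_true, if_true, Flow, Counting, Move.o, Move.u, and_assoc,
      exists_and_left, exists_eq_left, Bool.false_eq_true, if_false]
    simp only [tick_comm (w := w 1) (w' := w 0), tick_comm (w := w 2) (w' := w 0),
      tick_comm (w := w 2) (w' := w 1)]
    tauto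
  case Ω1a | Ω1b | Ω1c | Ω1d =>
    refine admits_one.trans (Iff.trans ?_ admits_one.symm)
    simp only [Flow, Counting, Move.o, Move.u, tick]
    constructor
    · rintro ⟨-, h⟩
      exact ⟨fun c => ((a 0).1.1, (a 0).1.1), (a 0).1, by grind⟩
    · rintro ⟨w, h⟩
      exact ⟨w, by grind⟩
  all_goals
    refine admits_two.trans (Iff.trans ?_ admits_two.symm)
    simp only [Flow, Counting, Move.o, Move.u, and_assoc,
      exists_and_left, exists_eq_left, Bool.false_eq_true, if_false, if_true]
    simp only [reduceCtorEq, IsEmpty.forall_iff, forall_const] at ha hb hc hd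
    -- the second tick of a strand undoes its first one
    have hcancel : ∀ upper positive w n, (upper = r → positive = e) →
        tick r e upper (!positive) w (tick r e upper positive w n) = n :=
      fun _ _ _ _ => tick_cancel
    have htt := hcancel true true
    have htf := hcancel true false
    have hft := hcancel false true
    have hff := hcancel false false
    clear hcancel
    cases r <;> cases e <;> simp at ha hb hc hd <;>
    · simp only [Bool.not_true, Bool.not_false, reduceCtorEq, IsEmpty.forall_iff,
        forall_const] at htt htf hft hff
      constructor
      · rintro ⟨h, -, h'⟩
        refine ⟨fun c => ((a 0).1.1, (a 1).1.1), ?_⟩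
        simp only [htt, htf, hft, hff, h, h', and_self]
      · rintro ⟨w, h⟩
        -- both crossings are crossings of the same two strands
        have hw : w 1 = w 0 := by grind
        simp only [hw, htt, htf, hft, hff] at h
        exact ⟨h.2.2.1, w, h.2.2.2.2.2⟩

/-- The loop of a move of type one outside the list is first passed on the other level, a bigon has
two opposite signs and is first passed on the same level at both crossings, and a move of type three
preserves the order of the two passages of each crossing, however its strands are connected
outside. -/
theorem firstWrithe_local {t : Bool} {Ω : Move}
    (h1 : Ω ∉ (if t then [.Ω1a, .Ω1d] else [.Ω1b, .Ω1c] : List Move))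
    (l : List (Fin Ω.strands)) (hl : l ∈ (List.finRange Ω.strands).permutations') :
    firstWrithe t (l.flatMap Ω.left) ∅ = firstWrithe t (l.flatMap Ω.right) ∅ := by
  revert l
  rcases Ω with _ | _ | _ | _ | _ | _ | _ | _ | ⟨_ | _, _ | _, _ | _⟩ <;> cases t <;>
    first
    | exact absurd (by decide) h1
    | decide +kernel

/-- Because the one-strand sums distinguish the sides of `Ω1a` and `Ω1b`, a generating set has to
change each of them. -/
theorem Generates.type_one {S : Finset Move} (hS : Generates S) :
    (.Ω1a ∈ S ∨ .Ω1d ∈ S) ∧ (.Ω1b ∈ S ∨ .Ω1c ∈ S) := by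
  constructor
  · by_contra! h
    have := (hS .Ω1a).firstWrithe_eq (t := true) fun Ω hΩ => firstWrithe_local (by
      rintro hm
      simp only [if_true, List.mem_cons, List.not_mem_nil, or_false] at hm
      rcases hm with rfl | rfl <;> tauto)
    exact absurd this (by decide)
  · by_contra! h
    have := (hS .Ω1b).firstWrithe_eq (t := false) fun Ω hΩ => firstWrithe_local (by
      rintro hm
      simp only [Bool.false_eq_true, if_false, List.mem_cons, List.not_mem_nil, or_false] at hm
      rcases hm with rfl | rfl <;> tauto)
    exact absurd this (by decide)

/-- Otherwise smoothing the crossings would connect the ends in the same way on both sides of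
`Ω2c`. -/
theorem Generates.opposite_type_two {S : Finset Move} (hS : Generates S)
    (h3 : ∀ tm tb mb, Move.Ω3 tm tb mb ∈ S → Move.Ω3 tm tb mb = .Ω3b) :
    .Ω2c ∈ S ∨ .Ω2d ∈ S := by
  by_contra! h
  have := ((hS .Ω2c).admits_iff (T := Smoothing) fun Ω hΩ => smoothing_local
    (fun h' => h.1 (h' ▸ hΩ)) (fun h' => h.2 (h' ▸ hΩ))
    (fun tm tb mb h' => h' ▸ h3 tm tb mb (h' ▸ hΩ))) fun i => (i == (0 : Fin 2), i == (0 : Fin 2))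
  have h1 := this.1 (admits_two.2 ⟨fun _ => (true, true), rfl, rfl⟩)
  obtain ⟨w, h2⟩ := admits_two.1 h1
  simp [Flow, Smoothing, Move.o, Move.u] at h2
  grind

/-- One of the two moves of type two in which the sign `e` is met second on level `r` is needed: the
moves excluded are just those left out in `counting_local`. -/
theorem Generates.type_two_of_level_of_sign {S : Finset Move} (hS : Generates S)
    (h3 : ∀ tm tb mb, Move.Ω3 tm tb mb ∈ S → Move.Ω3 tm tb mb = .Ω3b) (r e : Bool) :
    (if e then .Ω2b else .Ω2a) ∈ S ∨ (if r = e then .Ω2c else .Ω2d) ∈ S := by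
  by_contra! h
  -- On level `r` this move meets the sign `e` second. So it takes the counter `0` of the strand on
  -- that level, which stays `0` at first, to `1`.
  have := ((hS (if e then .Ω2b else .Ω2a)).admits_iff (T := Counting r e) fun Ω hΩ =>
    counting_local (by grind) (by grind) (by grind) (by grind)
    (fun tm tb mb h' => h' ▸ h3 tm tb mb (h' ▸ hΩ)))
  cases e
  · have h1 := (this fun i => ((i == (1 : Fin 2), 0), (i == (1 : Fin 2), 0))).1
      (admits_two.2 ⟨fun _ => (true, true), rfl, rfl⟩)
    obtain ⟨w, h2⟩ := admits_two.1 h1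
    cases r <;> simp [Flow, Counting, Move.o, Move.u, tick] at h2 <;> grind
  · have h1 := (this fun i => ((i == (1 : Fin 2), 0), (i == (1 : Fin 2), 0))).1
      (admits_two.2 ⟨fun _ => (true, true), rfl, rfl⟩)
    obtain ⟨w, h2⟩ := admits_two.1 h1
    cases r <;> simp [Flow, Counting, Move.o, Move.u, tick] at h2 <;> grind

/-- Beside `Ω3b` and two moves of type one, there is room for two moves of type two only. -/
theorem Generates.type_two {S : Finset Move} (hS : Generates S) (hcard : S.card ≤ 5)
    (h3 : ∀ tm tb mb, Move.Ω3 tm tb mb ∈ S ↔ Move.Ω3 tm tb mb = .Ω3b) :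
    .Ω2c ∈ S ∧ .Ω2d ∈ S := by
  have h3' := fun tm tb mb => (h3 tm tb mb).1
  have hb := (h3 true true true).2 rfl
  have h1 := hS.type_one
  have hs := hS.opposite_type_two h3'
  have hc := hS.type_two_of_level_of_sign h3'
  have h4 := hc true true
  have h5 := hc true false
  have h6 := hc false true
  have h7 := hc false false
  simp only [if_true, Bool.false_eq_true, if_false, Bool.true_eq_false] at h4 h5 h6 h7
  obtain ⟨x, hx, hxS⟩ : ∃ x ∈ ([.Ω1a, .Ω1d] : List Move), x ∈ S := by simpa using hS.type_one.1
  obtain ⟨y, hy, hyS⟩ : ∃ y ∈ ([.Ω1b, .Ω1c] : List Move), y ∈ S := by simpa using hS.type_one.2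
  have key : ∀ z ∈ ([.Ω2c, .Ω2d] : List Move), .Ω2a ∈ S → .Ω2b ∈ S → z ∈ S → False := by
    intro z hz ha hb' hzS
    have h6 : ({x, y, .Ω3b, .Ω2a, .Ω2b, z} : Finset Move).card = 6 := by
      simp only [List.mem_cons, List.not_mem_nil, or_false] at hx hy hz
      rcases hx with rfl | rfl <;> rcases hy with rfl | rfl <;> rcases hz with rfl | rfl <;> rfl
    have := Finset.card_le_card (s := {x, y, .Ω3b, .Ω2a, .Ω2b, z}) (t := S) (by
      simp only [Finset.insert_subset_iff, Finset.singleton_subset_iff]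
      exact ⟨hxS, hyS, hb, ha, hb', hzS⟩)
    omega
  have hkc := key .Ω2c (by simp)
  have hkd := key .Ω2d (by simp)
  -- Without `Ω2c` the conditions require `Ω2b`, `Ω2a` and `Ω2d`; without `Ω2d` they require `Ω2a`,
  -- `Ω2b` and `Ω2c`. Both are three moves of type two.
  clear key h3 h3' hc hb hxS hyS
  tauto

end Necessity

/-! ### Renaming crossings -/

section Relabel

variable {m k : ℕ}

/-- The diagram with its crossings renamed. -/
def Code.relabel (σ : Equiv.Perm ℕ) (D : Code m) : Code m :=
  fun i => (D i).map (Passage.relabel σ)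

/-- The outside of a changing disk with its crossings renamed. -/
def Outside.relabel (σ : Equiv.Perm ℕ) (K : Outside m k) : Outside m k :=
  fun i => (K i).map (Sum.map (Passage.relabel σ) id)

theorem Passage.relabel_injective (σ : Equiv.Perm ℕ) :
    Function.Injective (Passage.relabel σ) := by
  rintro ⟨c, u, s⟩ ⟨c', u', s'⟩ h
  simpa [Passage.relabel] using h

theorem Code.relabel_inv_relabel (σ : Equiv.Perm ℕ) (D : Code m) :
    (D.relabel σ).relabel σ⁻¹ = D := by
  funext i
  simp [Code.relabel, Function.comp_def, Passage.relabel]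

theorem Outside.relabel_fill (σ : Equiv.Perm ℕ) (K : Outside m k) (R : Code k) :
    (K.fill R).relabel σ = (K.relabel σ).fill (R.relabel σ) := by
  funext i
  simp only [Code.relabel, fill_eq, Outside.relabel, List.map_flatMap, List.flatMap_map]
  congr 1
  funext x
  cases x <;> rfl

theorem Outside.Linear.relabel {K : Outside m k} (hK : K.Linear) (σ : Equiv.Perm ℕ) :
    (K.relabel σ).Linear := by
  intro h
  rw [← hK h]
  refine Finset.sum_congr rfl fun i _ => ?_
  rw [Outside.relabel, List.count_eq_countP, List.countP_map, List.count_eq_countP]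
  congr 1
  funext x
  cases x <;> rfl

theorem Code.passages_relabel (σ : Equiv.Perm ℕ) (D : Code m) :
    (D.relabel σ).passages = D.passages.map (Passage.relabel σ) := by
  rw [Code.passages, Code.passages, List.map_flatten, List.map_ofFn]
  rfl

theorem Code.Valid.relabel {D : Code m} (hD : D.Valid) (σ : Equiv.Perm ℕ) :
    (D.relabel σ).Valid := by
  rw [Code.Valid, Code.passages_relabel]
  constructor
  · have := hD.1.map (f := fun x : ℕ × Bool => (σ x.1, x.2)) fun x y h => by
      simpa [Prod.ext_iff] using h
    rw [List.map_map] at this ⊢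
    exact this
  · intro p hp
    obtain ⟨q, hq, rfl⟩ := List.mem_map.1 hp
    exact List.mem_map.2 ⟨q.partner, hD.2 q hq, rfl⟩

theorem Code.locate_relabel (σ : Equiv.Perm ℕ) (D : Code m) (p : Passage) :
    (D.relabel σ).locate (p.relabel σ) = D.locate p := by
  unfold Code.locate Code.relabel
  congr 1
  funext i
  rw [List.findIdx?_map]
  congr 2
  funext q
  simp [(Passage.relabel_injective σ).eq_iff]

theorem Code.head_relabel (σ : Equiv.Perm ℕ) (D : Code m) (d : Dart m) :
    (D.relabel σ).head d = (D.head d).map (Passage.relabel σ) id := by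
  obtain ⟨i, j, f⟩ := d
  cases f
  · cases j with
    | zero => rfl
    | succ j =>
      simp only [Code.head, Code.relabel, List.getElem?_map, Bool.false_eq_true, if_false]
      cases (D i)[j]? <;> rfl
  · simp only [Code.head, Code.relabel, List.getElem?_map, if_true]
    cases (D i)[j]? <;> rfl

theorem Code.faceNext_relabel (b : Boundary m) (σ : Equiv.Perm ℕ) (D : Code m) :
    (D.relabel σ).faceNext b = D.faceNext b := by
  funext d
  rw [Code.faceNext, Code.faceNext, Code.head_relabel]
  cases D.head d with
  | inl p =>
    have h := D.locate_relabel σ p.partner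
    simp only [Sum.map_inl]
    rw [show (Passage.relabel σ p).partner = Passage.relabel σ p.partner from rfl, h]
    rfl
  | inr e => simp [Code.entering, Code.relabel]

theorem Code.darts_relabel (σ : Equiv.Perm ℕ) (D : Code m) : (D.relabel σ).darts = D.darts := by
  simp [Code.darts, Code.relabel]

theorem Code.crossings_relabel (σ : Equiv.Perm ℕ) (D : Code m) :
    (D.relabel σ).crossings = D.crossings := by
  rw [Code.crossings, Code.passages_relabel, List.filter_map, List.length_map]
  rfl

theorem Code.Planar.relabel {b : Boundary m} {D : Code m} (hD : D.Planar b) (σ : Equiv.Perm ℕ) :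
    (D.relabel σ).Planar b := by
  have : (D.relabel σ).faces b = D.faces b := by
    have h : (D.relabel σ).face b = D.face b := by
      funext d
      simp only [Code.face, Code.darts_relabel, Code.faceNext_relabel]
    rw [Code.faces, h, Code.darts_relabel, Code.faces]
  rw [Code.Planar, this, Code.crossings_relabel]
  exact hD

/-- A tangle diagram with its crossings renamed. -/
def Tangle.relabel {b : Boundary m} (σ : Equiv.Perm ℕ) (D : Tangle b) : Tangle b :=
  ⟨D.code.relabel σ, D.valid.relabel σ, D.planar.relabel σ⟩

theorem Obtainable.relabel {S : Finset Move} {b : Boundary m} (σ : Equiv.Perm ℕ) (D : Tangle b) :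
    Obtainable S D (D.relabel σ) :=
  .rel _ _ (.isotopy ⟨σ, fun _ => rfl⟩)

/-- The names of the crossings in a move are irrelevant. -/
theorem Obtainable.of_fill {S : Finset Move} {b : Boundary m} {D D' : Tangle b} {Ω : Move}
    (hΩ : Ω ∈ S) (σ : Equiv.Perm ℕ) {K : Outside m Ω.strands} (hK : K.Linear)
    (hD : D.code = K.fill (Ω.left.relabel σ)) (hD' : D'.code = K.fill (Ω.right.relabel σ)) :
    Obtainable S D D' := by
  refine .trans _ _ _ (Obtainable.relabel σ⁻¹ D) (.trans _ (D'.relabel σ⁻¹) _ (.rel _ _ (.move Ω hΩ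
    ⟨K.relabel σ⁻¹, hK.relabel _, ?_, ?_⟩)) (.symm _ _ (Obtainable.relabel σ⁻¹ D')))
  · change D.code.relabel σ⁻¹ = _
    rw [hD, Outside.relabel_fill, Code.relabel_inv_relabel]
  · change D'.code.relabel σ⁻¹ = _
    rw [hD', Outside.relabel_fill, Code.relabel_inv_relabel]

end Relabel

/-! ### Counting faces by tracing them -/

section Faces

variable {m : ℕ}

/-- If the darts are arranged in cycles of `faceNext`, then these are the faces. -/
theorem Code.card_faces {b : Boundary m} {D : Code m} {cs : List (List (Dart m))}
    (hne : ∀ l ∈ cs, l ≠ []) (hcyc : ∀ l ∈ cs, l.map (D.faceNext b) = l.rotate 1)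
    (hnd : cs.flatten.Nodup) (hmem : ∀ d, d ∈ D.darts ↔ d ∈ cs.flatten) :
    (D.faces b).card = cs.length := by
  obtain ⟨hnd₁, hnd₂⟩ := List.nodup_flatten.1 hnd
  have hface : ∀ l ∈ cs, ∀ d ∈ l, D.face b d = l.toFinset := by
    intro l hc d hd
    have hlen : l.length ≤ D.darts.card := by
      rw [← List.toFinset_card_of_nodup (hnd₁ l hc)]
      refine Finset.card_le_card fun x hx => (hmem x).2 ?_
      exact List.mem_flatten.2 ⟨l, hc, List.mem_toFinset.1 hx⟩
    have hiter : ∀ n, l.map (D.faceNext b)^[n] = l.rotate n := by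
      intro n
      induction n with
      | zero => simp
      | succ n ih =>
        rw [Function.iterate_succ, ← List.map_map, hcyc l hc, List.map_rotate, ih,
          List.rotate_rotate]
    obtain ⟨k, hk, rfl⟩ := List.mem_iff_getElem.1 hd
    have hget : ∀ n, (D.faceNext b)^[n] l[k] =
        l[(k + n) % l.length]'(Nat.mod_lt _ (Nat.zero_lt_of_lt hk)) := by
      intro n
      rw [← List.getElem_rotate l n k (by simpa using hk)]
      simp only [← hiter n, List.getElem_map]
    ext x
    simp only [Code.face, Finset.mem_image, Finset.mem_range, List.mem_toFinset, hget]
    constructor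
    · rintro ⟨n, -, rfl⟩
      exact List.getElem_mem _
    · intro hx
      obtain ⟨j, hj, rfl⟩ := List.mem_iff_getElem.1 hx
      refine ⟨(j + (l.length - k)) % l.length, (Nat.mod_lt _ (by omega)).trans_le hlen, ?_⟩
      congr 1
      rw [Nat.add_mod_mod, show k + (j + (l.length - k)) = j + l.length by omega,
        Nat.add_mod_right, Nat.mod_eq_of_lt hj]
  have himg : D.faces b = (cs.map List.toFinset).toFinset := by
    ext s
    simp only [Code.faces, Finset.mem_image, List.mem_toFinset, List.mem_map, hmem,
      List.mem_flatten]
    constructor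
    · rintro ⟨d, ⟨l, hc, hd⟩, rfl⟩
      exact ⟨l, hc, (hface l hc d hd).symm⟩
    · rintro ⟨l, hc, rfl⟩
      obtain ⟨d, hd⟩ := List.exists_mem_of_ne_nil l (hne l hc)
      exact ⟨d, ⟨l, hc, hd⟩, hface l hc d hd⟩
  rw [himg, List.toFinset_card_of_nodup, List.length_map]
  rw [List.Nodup, List.pairwise_map]
  refine hnd₂.imp_of_mem fun {l l'} hc hc' hdis heq => ?_
  obtain ⟨d, hd⟩ := List.exists_mem_of_ne_nil l (hne l hc)
  exact hdis hd (List.mem_toFinset.1 (heq ▸ List.mem_toFinset.2 hd))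

/-- The darts of a diagram as a list. -/
def Code.dartList (D : Code m) : List (Dart m) :=
  (List.finRange m).flatMap fun i => (List.range ((D i).length + 1)).flatMap fun j =>
    [⟨i, j, true⟩, ⟨i, j, false⟩]

theorem Code.mem_dartList {D : Code m} {d : Dart m} : d ∈ D.dartList ↔ d ∈ D.darts := by
  simp [Code.dartList, Code.darts]

theorem Code.nodup_dartList (D : Code m) : D.dartList.Nodup := by
  simp only [Code.dartList, List.nodup_flatMap]
  refine ⟨fun i _ => ⟨fun j _ => by simp, ?_⟩, ?_⟩
  · refine (List.nodup_range).imp fun hne => ?_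
    simp [Function.onFun, hne.symm]
  · refine (List.nodup_finRange m).imp fun hne => ?_
    simp only [Function.onFun, List.disjoint_left, List.mem_flatMap]
    rintro d ⟨j, -, hd⟩ ⟨j', -, hd'⟩
    apply hne
    rcases List.mem_pair.1 hd with rfl | rfl <;> rcases List.mem_pair.1 hd' with h | h <;>
      exact congrArg Dart.strand h

/-- Equality of darts, for fast evaluation. -/
def Dart.same (d e : Dart m) : Bool :=
  Nat.beq d.arc e.arc && (Nat.beq d.strand e.strand && cond d.forward e.forward !e.forward)

theorem Dart.same_iff {d e : Dart m} : d.same e = true ↔ d = e := by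
  obtain ⟨i, j, f⟩ := d
  obtain ⟨i', j', f'⟩ := e
  cases f <;> cases f' <;> simp [Dart.same, Fin.ext_iff, and_comm]

/-- The darts met from `d` on, up to the first return to `d₀`, but at most `n`. -/
def traceFace (f : Dart m → Dart m) (d₀ : Dart m) : ℕ → Dart m → List (Dart m)
  | 0, _ => []
  | n + 1, d => bif d.same d₀ then [] else d :: traceFace f d₀ n (f d)

/-- The faces of `D`, each as the list of the darts along its boundary. -/
def Code.faceCycles (b : Boundary m) (D : Code m) : List (List (Dart m)) :=
  D.dartList.foldl (fun cs d => bif cs.any fun l => l.any d.same then cs else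
    (d :: traceFace (D.faceNext b) d D.dartList.length (D.faceNext b d)) :: cs) []

/-- A test for planarity that computes each value of `faceNext` only a few times. -/
def Code.planarTest (b : Boundary m) (D : Code m) : Bool :=
  let cs := D.faceCycles b
  cs.all (fun l => !l.isEmpty && l.map (D.faceNext b) == l.rotate 1) &&
    (cs.flatten.length == D.dartList.length &&
      (D.dartList.all (fun d => cs.flatten.any d.same) &&
        D.crossings + 1 + cs.length == 2 * D.crossings + m + 2))

theorem Code.planar_of_planarTest {b : Boundary m} {D : Code m} (h : D.planarTest b = true) :
    D.Planar b := by
  simp only [Code.planarTest, Bool.and_eq_true, List.all_eq_true, Bool.not_eq_true',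
    List.isEmpty_eq_false_iff, beq_iff_eq, List.any_eq_true, Dart.same_iff, exists_eq_right'] at h
  obtain ⟨h1, h2, h3, h4⟩ := h
  have h5 := (D.nodup_dartList.subperm h3).perm_of_length_le h2.le
  have h6 := Code.card_faces (fun c hc => (h1 c hc).1) (fun c hc => (h1 c hc).2)
    (h5.nodup_iff.1 D.nodup_dartList) fun d => Code.mem_dartList.symm.trans h5.mem_iff
  rw [Code.Planar, h6]
  omega

end Faces

/-! ### Routes: sequences of moves written out diagram by diagram -/

section Routes

variable {m k : ℕ}

/-- One move of a route: the move, the names of its crossings `0, 1, …` (which may be followed by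
names for use in `Leg.expand`), whether its inverse is applied, and the resulting
diagram. -/
structure Leg (m : ℕ) where
  move : Move
  names : List ℕ
  undo : Bool
  next : Code m

/-- A permutation that sends `0, 1, …` to the entries of a list without repetitions. -/
def naming (names : List ℕ) : Equiv.Perm ℕ :=
  names.zipIdx.foldl (fun τ x => Equiv.swap (τ x.2) x.1 * τ) 1

/-- The outside of a changing disk in which `C` looks as `R`. It has the intended meaning only if
the strands of `R` are non-empty and are pieces of strands of `C`. -/
def Code.cut (C : Code m) (R : Code k) : Outside m k := fun i =>
  (C i).filterMap fun p =>
    match (List.finRange k).find? fun h => (R h).contains p with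
    | none => some (Sum.inl p)
    | some h => if (R h).head? = some p then some (Sum.inr h) else none

/-- The leg leads from `C` to its resulting diagram, by a move of `S` or its inverse. -/
def Leg.legal (S : List Move) (C : Code m) (l : Leg m) : Bool :=
  let K := (if l.undo then C else l.next).cut (l.move.right.relabel (naming l.names))
  decide (l.move ∈ S) && (decide (∀ h, ∑ i, (K i).count (Sum.inr h) = 1) &&
    (decide (∀ i, (if l.undo then l.next else C) i =
        K.fill (l.move.left.relabel (naming l.names)) i) &&
      decide (∀ i, (if l.undo then C else l.next) i =
        K.fill (l.move.right.relabel (naming l.names)) i)))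

/-- All legs of the route from `C` are legal and lead to diagrams in the disk. -/
def legalRoute (S : List Move) (b : Boundary m) : Code m → List (Leg m) → Bool
  | _, [] => true
  | C, l :: L => l.legal S C &&
      (decide l.next.Valid && (l.next.planarTest b && legalRoute S b l.next L))

/-- The last diagram of a route. -/
def routeEnd : Code m → List (Leg m) → Code m
  | C, [] => C
  | _, l :: L => routeEnd l.next L

theorem Obtainable.of_leg {S : List Move} {b : Boundary m} {D D' : Tangle b} {l : Leg m}
    (h : l.legal S D.code = true) (hD' : D'.code = l.next) : Obtainable S.toFinset D D' := by
  obtain ⟨Ω, names, undo, next⟩ := l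
  subst hD'
  simp only [Leg.legal, Bool.and_eq_true, decide_eq_true_eq] at h
  obtain ⟨h1, h2, h3, h4⟩ := h
  have h1' := List.mem_toFinset.2 h1
  cases undo with
  | false => exact Obtainable.of_fill h1' _ h2 (funext h3) (funext h4)
  | true => exact .symm _ _ (Obtainable.of_fill h1' _ h2 (funext h3) (funext h4))

theorem Obtainable.of_legalRoute {S : List Move} {b : Boundary m} {L : List (Leg m)}
    {D D' : Tangle b} (h : legalRoute S b D.code L = true) (hD' : D'.code = routeEnd D.code L) :
    Obtainable S.toFinset D D' := by
  induction L generalizing D with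
  | nil =>
    obtain ⟨C, _, _⟩ := D
    obtain ⟨C', _, _⟩ := D'
    cases hD'
    exact .refl _
  | cons l L ih =>
    simp only [legalRoute, Bool.and_eq_true, decide_eq_true_eq] at h
    obtain ⟨h1, h2, h3, h4⟩ := h
    exact .trans _ ⟨l.next, h2, Code.planar_of_planarTest h3⟩ _ (Obtainable.of_leg h1 rfl)
      (ih h4 hD')

/-- Replaces a leg that starts at `C` by the route `r` for its move, drawn inside the
changing disk. The crossings of the diagrams of `r` get the names listed in the leg. -/
def Leg.expand (C : Code m) (l : Leg m) (r : List (Leg l.move.strands)) : List (Leg m) :=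
  let σ := naming l.names
  let K := (if l.undo then C else l.next).cut (l.move.right.relabel σ)
  let r' := r.map fun x => ⟨x.move, x.names.map σ, x.undo, K.fill (x.next.relabel σ)⟩
  if l.undo then
    (r'.zip (K.fill (l.move.left.relabel σ) :: r'.map Leg.next)).reverse.map fun x =>
      ⟨x.1.move, x.1.names, !x.1.undo, x.2⟩
  else r'

/-- Replaces all legs with moves in `P` by the routes `r`. -/
def expandRoute (P : List Move) (r : ∀ Ω : Move, List (Leg Ω.strands)) :
    Code m → List (Leg m) → List (Leg m)
  | _, [] => []
  | C, l :: L =>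
      (if l.move ∈ P then l.expand C (r l.move) else [l]) ++ expandRoute P r l.next L

end Routes

/-! ### The routes for the moves to be generated -/

section Data

/-- Passage over a positive crossing. -/
def op (c : ℕ) : Passage := ⟨c, true, true⟩

/-- Passage over a negative crossing. -/
def om (c : ℕ) : Passage := ⟨c, true, false⟩

/-- Passage under a positive crossing. -/
def up (c : ℕ) : Passage := ⟨c, false, true⟩

/-- Passage under a negative crossing. -/
def um (c : ℕ) : Passage := ⟨c, false, false⟩

/-- Routes from the left to the right side of a move. Apart from `Ω2c`, `Ω2d` and `Ω3b`, they use
one move of type one for another one, `Ω1b` and `Ω1c` for `Ω2a` and `Ω2b`, and `Ω2a` and `Ω2b` for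
the moves of type three. -/
def route : (Ω : Move) → List (Leg Ω.strands)
  | .Ω1a => [
      ⟨.Ω2d, [0, 1], false, ![[op 0, om 1, um 1, up 0]]⟩,
      ⟨.Ω1d, [1], true, ![[op 0, up 0]]⟩]
  | .Ω1b => [
      ⟨.Ω2c, [1, 0], false, ![[up 0, um 1, om 1, op 0]]⟩,
      ⟨.Ω1c, [1], true, ![[up 0, op 0]]⟩]
  | .Ω1c => [
      ⟨.Ω2d, [1, 0], false, ![[um 0, up 1, op 1, om 0]]⟩,
      ⟨.Ω1b, [1], true, ![[um 0, om 0]]⟩]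
  | .Ω1d => [
      ⟨.Ω2c, [0, 1], false, ![[om 0, op 1, up 1, um 0]]⟩,
      ⟨.Ω1a, [1], true, ![[om 0, um 0]]⟩]
  | .Ω2a => [
      ⟨.Ω1c, [2, 20], false, ![[um 2, om 2], []]⟩,
      ⟨.Ω2d, [0, 3], false, ![[um 2, op 0, om 3, om 2], [um 3, up 0]]⟩,
      ⟨.Ω1b, [4, 20], false, ![[um 2, op 0, up 4, op 4, om 3, om 2], [um 3, up 0]]⟩,
      ⟨.Ω2c, [1, 5], false,
        ![[um 2, op 0, up 4, om 1, op 5, op 4, om 3, om 2], [um 3, up 0, up 5, um 1]]⟩,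
      ⟨.Ω3b, [4, 5, 0], true,
        ![[um 2, up 4, op 0, om 1, op 4, op 5, om 3, om 2], [um 3, up 5, up 0, um 1]]⟩,
      ⟨.Ω2d, [5, 3], true, ![[um 2, up 4, op 0, om 1, op 4, om 2], [up 0, um 1]]⟩,
      ⟨.Ω2d, [4, 2], true, ![[op 0, om 1], [up 0, um 1]]⟩]
  | .Ω2b => [
      ⟨.Ω1c, [2, 20], false, ![[], [um 2, om 2]]⟩,
      ⟨.Ω2d, [1, 3], false, ![[op 1, om 3], [um 2, um 3, up 1, om 2]]⟩,
      ⟨.Ω1b, [4, 20], false, ![[op 1, om 3], [um 2, um 3, up 4, op 4, up 1, om 2]]⟩,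
      ⟨.Ω2c, [0, 5], false,
        ![[om 0, op 5, op 1, om 3], [um 2, um 3, up 4, up 5, um 0, op 4, up 1, om 2]]⟩,
      ⟨.Ω3b, [1, 5, 4], true,
        ![[om 0, op 1, op 5, om 3], [um 2, um 3, up 5, up 4, um 0, up 1, op 4, om 2]]⟩,
      ⟨.Ω2d, [5, 3], true, ![[om 0, op 1], [um 2, up 4, um 0, up 1, op 4, om 2]]⟩,
      ⟨.Ω2d, [4, 2], true, ![[om 0, op 1], [um 0, up 1]]⟩]
  | .Ω3 false false false => [
      ⟨.Ω2a, [3, 4, 10, 11, 12, 13], false,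
        ![[om 1, om 0], [om 2, um 0, op 3, om 4], [um 2, um 1, up 3, um 4]]⟩,
      ⟨.Ω2c, [5, 6], false,
        ![[om 5, op 6, om 1, om 0], [om 2, um 0, op 3, up 6, um 5, om 4],
          [um 2, um 1, up 3, um 4]]⟩,
      ⟨.Ω2c, [7, 8], false,
        ![[om 5, om 7, op 8, op 6, om 1, om 0], [om 2, um 0, op 3, up 6, um 5, om 4],
          [um 2, um 1, up 3, up 8, um 7, um 4]]⟩,
      ⟨.Ω3b, [6, 8, 3], true,
        ![[om 5, om 7, op 6, op 8, om 1, om 0], [om 2, um 0, up 6, op 3, um 5, om 4],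
          [um 2, um 1, up 8, up 3, um 7, um 4]]⟩,
      ⟨.Ω2d, [8, 1], true,
        ![[om 5, om 7, op 6, om 0], [om 2, um 0, up 6, op 3, um 5, om 4],
          [um 2, up 3, um 7, um 4]]⟩,
      ⟨.Ω2d, [6, 0], true, ![[om 5, om 7], [om 2, op 3, um 5, om 4], [um 2, up 3, um 7, um 4]]⟩,
      ⟨.Ω2b, [2, 3, 10, 11, 12, 13], true, ![[om 5, om 7], [um 5, om 4], [um 7, um 4]]⟩]
  | .Ω3 false false true => [
      ⟨.Ω2c, [3, 4], false, ![[om 3, op 4, om 1, om 0], [um 0, op 2, up 4, um 3], [um 1, up 2]]⟩,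
      ⟨.Ω2c, [5, 6], false,
        ![[om 3, om 5, op 6, op 4, om 1, om 0], [um 0, op 2, up 4, um 3],
          [um 1, up 2, up 6, um 5]]⟩,
      ⟨.Ω3b, [4, 6, 2], true,
        ![[om 3, om 5, op 4, op 6, om 1, om 0], [um 0, up 4, op 2, um 3],
          [um 1, up 6, up 2, um 5]]⟩,
      ⟨.Ω2d, [6, 1], true, ![[om 3, om 5, op 4, om 0], [um 0, up 4, op 2, um 3], [up 2, um 5]]⟩,
      ⟨.Ω2d, [4, 0], true, ![[om 3, om 5], [op 2, um 3], [up 2, um 5]]⟩]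
  | .Ω3 false true false => [
      ⟨.Ω2d, [3, 4], false, ![[om 0, op 1, op 3, om 4], [um 4, up 3, om 2, um 0], [up 1, um 2]]⟩,
      ⟨.Ω2b, [5, 6, 10, 11, 12, 13], false,
        ![[om 0, op 1, op 3, om 4], [um 4, om 5, op 6, up 3, om 2, um 0],
          [um 5, up 6, up 1, um 2]]⟩,
      ⟨.Ω3b, [3, 1, 6], true,
        ![[om 0, op 3, op 1, om 4], [um 4, om 5, up 3, op 6, om 2, um 0],
          [um 5, up 1, up 6, um 2]]⟩,
      ⟨.Ω2a, [6, 2, 10, 11, 12, 13], true,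
        ![[om 0, op 3, op 1, om 4], [um 4, om 5, up 3, um 0], [um 5, up 1]]⟩,
      ⟨.Ω2c, [0, 3], true, ![[op 1, om 4], [um 4, om 5], [um 5, up 1]]⟩]
  | .Ω3 false true true => [
      ⟨.Ω2a, [3, 4, 10, 11, 12, 13], false,
        ![[om 0, op 1, op 3, om 4], [um 0, op 2, up 3, um 4], [up 2, up 1]]⟩,
      ⟨.Ω3b, [3, 1, 2], true, ![[om 0, op 3, op 1, om 4], [um 0, up 3, op 2, um 4], [up 1, up 2]]⟩,
      ⟨.Ω2b, [0, 3, 10, 11, 12, 13], true, ![[op 1, om 4], [op 2, um 4], [up 1, up 2]]⟩]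
  | .Ω3 true false false => [
      ⟨.Ω2d, [3, 4], false, ![[om 1, op 0], [om 2, up 0, op 3, om 4], [um 4, up 3, um 1, um 2]]⟩,
      ⟨.Ω2d, [5, 6], false,
        ![[om 1, op 0, op 5, om 6], [om 2, up 0, op 3, om 4],
          [um 4, um 6, up 5, up 3, um 1, um 2]]⟩,
      ⟨.Ω3b, [0, 5, 3], false,
        ![[om 1, op 5, op 0, om 6], [om 2, op 3, up 0, om 4],
          [um 4, um 6, up 3, up 5, um 1, um 2]]⟩,
      ⟨.Ω2c, [1, 5], true, ![[op 0, om 6], [om 2, op 3, up 0, om 4], [um 4, um 6, up 3, um 2]]⟩,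
      ⟨.Ω2c, [2, 3], true, ![[op 0, om 6], [up 0, om 4], [um 4, um 6]]⟩]
  | .Ω3 true false true => [
      ⟨.Ω2d, [3, 4], false, ![[om 1, op 0, op 3, om 4], [up 0, op 2], [um 4, up 3, up 2, um 1]]⟩,
      ⟨.Ω3b, [0, 3, 2], false, ![[om 1, op 3, op 0, om 4], [op 2, up 0], [um 4, up 2, up 3, um 1]]⟩,
      ⟨.Ω2c, [1, 3], true, ![[op 0, om 4], [op 2, up 0], [um 4, up 2]]⟩]
  | .Ω3 true true false => [
      ⟨.Ω2a, [3, 4, 10, 11, 12, 13], false,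
        ![[op 0, op 1], [om 2, up 0, op 3, om 4], [um 2, up 1, up 3, um 4]]⟩,
      ⟨.Ω3b, [0, 1, 3], false, ![[op 1, op 0], [om 2, op 3, up 0, om 4], [um 2, up 3, up 1, um 4]]⟩,
      ⟨.Ω2b, [2, 3, 10, 11, 12, 13], true, ![[op 1, op 0], [up 0, om 4], [up 1, um 4]]⟩]
  | .Ω2c | .Ω2d | .Ω3b => []

/-- The names of the crossings `0, 1, 2` of the right side at the end of the route. -/
def endNames : Move → List ℕ
  | .Ω3 false false false => [5, 7, 4]
  | .Ω3 false false true => [3, 5, 2]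
  | .Ω3 false true false => [4, 1, 5]
  | .Ω3 false true true => [4, 1, 2]
  | .Ω3 true false false => [0, 6, 4]
  | .Ω3 true false true => [0, 4, 2]
  | .Ω3 true true false => [0, 1, 4]
  | _ => []

end Data

/-! ### Generating all moves -/

section Sufficiency

theorem Obtainable.mono {S T : Finset Move} (h : S ⊆ T) {m : ℕ} {b : Boundary m} {D D' : Tangle b}
    (hD : Obtainable S D D') : Obtainable T D D' := by
  have hle : Step S (b := b) ≤ Step T := fun D D' hs => by
    cases hs with
    | isotopy hi => exact .isotopy hi
    | move Ω hΩ hR => exact .move Ω (h hΩ) hR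
  exact Relation.EqvGen.mono hle _ _ hD

theorem Obtainable.of_mem {S : Finset Move} {Ω : Move} (h : Ω ∈ S) :
    Obtainable S Ω.before Ω.after := by
  refine .rel _ _ (.move Ω h ⟨fun i => [Sum.inr i], fun j => ?_, ?_, ?_⟩)
  · rw [Finset.sum_eq_single j (fun i _ hij => ?_) (by simp)]
    · simp
    · exact List.count_eq_zero_of_not_mem (by simpa using hij.symm)
  all_goals
    funext i
    simp [Outside.fill_eq, piece]
    rfl

/-- The route for `Ω` with `Ω2a` and `Ω2b` and then the move `y` replaced by their routes consists
of moves of `S`. -/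
def routeTest (S : List Move) (y Ω : Move) : Bool :=
  let L := expandRoute [y] route Ω.left (expandRoute [.Ω2a, .Ω2b] route Ω.left (route Ω))
  legalRoute S Ω.boundary Ω.left L &&
    decide (∀ i, routeEnd Ω.left L i = Ω.right.relabel (naming (endNames Ω)) i)

theorem Obtainable.of_routeTest {S : List Move} {T : Finset Move} {y Ω : Move}
    (h : routeTest S y Ω = true) (hS : ∀ Ω ∈ S, Ω ∈ T) : Obtainable T Ω.before Ω.after := by
  simp only [routeTest, Bool.and_eq_true, decide_eq_true_eq] at h
  refine Obtainable.mono (S := S.toFinset) (fun Ω hΩ => hS Ω (List.mem_toFinset.1 hΩ)) ?_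
  exact .trans _ (Ω.after.relabel (naming (endNames Ω))) _
    (Obtainable.of_legalRoute h.1 (funext h.2).symm) (.symm _ _ (Obtainable.relabel _ _))

/-- The moves with routes that use `Ω1b` or `Ω1c`, beside `Ω2c`, `Ω2d` and `Ω3b`. -/
def routedMoves : List Move :=
  [.Ω2a, .Ω2b, .Ω3 false false false, .Ω3 false false true, .Ω3 false true false,
    .Ω3 false true true, .Ω3 true false false, .Ω3 true false true, .Ω3 true true false]

theorem routeTest_Ω1b : ∀ Ω ∈ routedMoves, routeTest [.Ω1b, .Ω2c, .Ω2d, .Ω3b] .Ω1c Ω = true := by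
  decide +kernel

theorem routeTest_Ω1c : ∀ Ω ∈ routedMoves, routeTest [.Ω1c, .Ω2c, .Ω2d, .Ω3b] .Ω1b Ω = true := by
  decide +kernel

theorem generates_of_mem {S : Finset Move} (hc : .Ω2c ∈ S) (hd : .Ω2d ∈ S) (h3 : .Ω3b ∈ S)
    (had : .Ω1a ∈ S ∨ .Ω1d ∈ S) (hbc : .Ω1b ∈ S ∨ .Ω1c ∈ S) : Generates S := by
  have hr : ∀ Ω ∈ routedMoves, Obtainable S Ω.before Ω.after := by
    intro Ω hΩ
    rcases hbc with h | h
    · exact .of_routeTest (routeTest_Ω1b Ω hΩ) (by simp [h, hc, hd, h3])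
    · exact .of_routeTest (routeTest_Ω1c Ω hΩ) (by simp [h, hc, hd, h3])
  rintro (_ | _ | _ | _ | _ | _ | _ | _ | ⟨tm, tb, mb⟩)
  · rcases had with h | h
    · exact .of_mem h
    · exact .of_routeTest (S := [.Ω1d, .Ω2d]) (y := .Ω3b) (by decide +kernel) (by simp [h, hd])
  · rcases hbc with h | h
    · exact .of_mem h
    · exact .of_routeTest (S := [.Ω1c, .Ω2c]) (y := .Ω3b) (by decide +kernel) (by simp [h, hc])
  · rcases hbc with h | h
    · exact .of_routeTest (S := [.Ω1b, .Ω2d]) (y := .Ω3b) (by decide +kernel) (by simp [h, hd])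
    · exact .of_mem h
  · rcases had with h | h
    · exact .of_routeTest (S := [.Ω1a, .Ω2c]) (y := .Ω3b) (by decide +kernel) (by simp [h, hc])
    · exact .of_mem h
  · exact hr _ (by simp [routedMoves])
  · exact hr _ (by simp [routedMoves])
  · exact .of_mem hc
  · exact .of_mem hd
  · by_cases h : tm = true ∧ tb = true ∧ mb = true
    · obtain ⟨rfl, rfl, rfl⟩ := h
      exact .of_mem h3
    · refine hr _ ?_
      revert tm tb mb
      decide

end Sufficiency

end Reidemeister

theorem theorem2 (S : Finset Reidemeister.Move) (hcard : S.card ≤ 5)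
    (htype3 : ∀ tm tb mb : Bool,
      Reidemeister.Move.Ω3 tm tb mb ∈ S ↔
        Reidemeister.Move.Ω3 tm tb mb = Reidemeister.Move.Ω3b) :
    Reidemeister.Generates S ↔
      (Reidemeister.Move.Ω2c ∈ S ∧ Reidemeister.Move.Ω2d ∈ S ∧
        ((Reidemeister.Move.Ω1a ∈ S ∧ Reidemeister.Move.Ω1b ∈ S) ∨
          (Reidemeister.Move.Ω1a ∈ S ∧ Reidemeister.Move.Ω1c ∈ S) ∨
          (Reidemeister.Move.Ω1b ∈ S ∧ Reidemeister.Move.Ω1d ∈ S) ∨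
          (Reidemeister.Move.Ω1c ∈ S ∧ Reidemeister.Move.Ω1d ∈ S))) := by
  constructor
  · intro h
    have h1 := h.type_one
    have h2 := h.type_two hcard htype3
    tauto
  · rintro ⟨hc, hd, h⟩
    exact Reidemeister.generates_of_mem hc hd ((htype3 true true true).2 rfl) (by tauto) (by tauto)
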